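/- Let $G$ be a path on $k\ge 1$ vertices, with vertex set $V$ and edge set $E$. Choose an orientation of each edge and let $E'\subseteq V\times V$ be the set of oriented edges. Let $\mathcal A_G$ be the automaton with alphabet $V$ and state set $E'\cup\{id\}$, where $id$ is a sink acting trivially, and where a state $e=(x,y)\in E'$ has output map $\eta(e,x)=y$, $\eta(e,y)=x$, $\eta(e,z)=z$ for $z\ne x,y$, and restriction map $\lambda(e,x)=e$, $\lambda(e,z)=id$ for $z\neq x$. The states act on words over $V$ by $\eta(q,zw)=\eta(q,z)\,\eta(\lambda(q,z),w)$. For $n\ge 1$ let $\Gamma_n^G$ be the $n$-th Schreier graph: its vertices are the words of length $n$ over $V$, and $u,v$ are joined by an edge whenever $\eta(q,u)=v$ for some state $q$ (edges are regarded as undirected; loops and multiple edges do not affect distances). The Wiener index $W(\Gamma)$ of a finite connected graph $\Gamma$ is the sum of the distances over all unordered pairs of vertices, $W(\Gamma)=\frac12\sum_{u}\sum_{v} d_\Gamma(u,v)$. Then, for every $n\ge 1$ and every choice of the orientation, $\Gamma_n^G$ is connected and $$ \begin{aligned} W(\Gamma_n^G) ={}& \frac{(k-1)^2(2k^2-2k-1)}{k^3(2k-1)}\cdot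 2^n k^{2n} + \frac{(k-1)(k-2)(k-3)}{3k^2}\cdot n k^{2n}\\ &- \frac{(k+1)(k-2)(k^2+2k-6)}{6k^3}\cdot k^{2n} + \frac{(k+1)(k-2)(2k-5)}{6k(2k-1)}\cdot k^n . \end{aligned} $$ -/

import Mathlib

namespace GraphAutomaton

/-- An automaton (transducer) with state set `Q` and alphabet `X`: `restr` is the restriction map
`λ` and `out` is the output map `η`. -/
structure Automaton (Q X : Type*) where
  restr : Q → X → Q
  out : Q → X → X

/-- The action of a state on words of length `n`, read from the first letter:
`η(q, x w) = η(q, x) η(λ(q, x), w)`. -/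
def Automaton.act {Q X : Type*} (A : Automaton Q X) : {n : ℕ} → Q → (Fin n → X) → (Fin n → X)
  | 0, _, w => w
  | _ + 1, q, w => Fin.cons (A.out q (w 0)) (A.act (A.restr q (w 0)) (Fin.tail w))

/-- The `n`-th Schreier graph: the vertices are the words of length `n`, and `u`, `v` are adjacent
when some state maps one of them to the other. Loops and repeated edges are not recorded, since they
do not affect distances. -/
def Automaton.schreierGraph {Q X : Type*} (A : Automaton Q X) (n : ℕ) : SimpleGraph (Fin n → X) :=
  SimpleGraph.fromRel fun u v => ∃ q : Q, A.act q u = v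

/-- An orientation of the edges of `G`: a set of ordered pairs containing, for each edge `{x, y}`,
exactly one of `(x, y)` and `(y, x)`, and nothing else. -/
structure EdgeOrientation {V : Type*} (G : SimpleGraph V) where
  arcs : Set (V × V)
  adj_of_mem : ∀ {x y : V}, (x, y) ∈ arcs → G.Adj x y
  xor_of_adj : ∀ {x y : V}, G.Adj x y → Xor ((x, y) ∈ arcs) ((y, x) ∈ arcs)

open Classical in
/-- The graph automaton of `G` for the chosen orientation. The states are the oriented edges together
with the sink `none`; the oriented edge `(x, y)` exchanges the letters `x` and `y`, restricts to
itself at `x` and to the sink at every other letter. -/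
noncomputable def graphAutomaton {V : Type*} {G : SimpleGraph V} (o : EdgeOrientation G) :
    Automaton (Option o.arcs) V where
  restr
    | none, _ => none
    | some e, z => if z = e.1.1 then some e else none
  out
    | none, z => z
    | some e, z => if z = e.1.1 then e.1.2 else if z = e.1.2 then e.1.1 else z

/-- The total distance of `v`: the sum of the distances of all vertices from `v`. -/
noncomputable def totalDist {V : Type*} [Fintype V] (G : SimpleGraph V) (v : V) : ℕ :=
  ∑ u, G.dist v u

/-- The Wiener index: the sum of the distances over all unordered pairs of vertices, that is, half
of the sum of the total distances of all vertices. -/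
noncomputable def wienerIndex {V : Type*} [Fintype V] (G : SimpleGraph V) : ℚ :=
  (1 / 2 : ℚ) * ∑ v, (totalDist G v : ℚ)

end GraphAutomaton

/-!
Identify the letters with the vertices of a path, so that the generators are the edges of the path;
the orientation does not matter, since reversing an edge inverts its generator. An edge acts on the
words in its two letters as a binary odometer, hence moves them along a cycle of length `2 ^ n`, and
the Schreier graph is a tree-like arrangement of cycles of lengths `2 ^ l`, any two of which share
at most one word. Every word projects to each of these cycles, and a generator advances exactly one
of the projections. The distance is therefore the sum over the cycles of the distances of the
projections. Appending a letter makes one copy of the graph for each letter and, for each edge,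
merges the two copies of its maximal cycle that belong to its ends; summing over all pairs of words
then gives linear recursions in `n`.
-/

namespace GraphAutomaton

section Metric

variable {V W : Type*} {G : SimpleGraph V} {H : SimpleGraph W}

lemma dist_map_iso (f : G ≃g H) (u v : V) : H.dist (f u) (f v) = G.dist u v := by
  by_cases h : G.Reachable u v
  · obtain ⟨p, hp⟩ := h.exists_walk_length_eq_dist
    obtain ⟨q, hq⟩ := (f.reachable_iff.2 h).exists_walk_length_eq_dist
    apply le_antisymm
    · simpa [hp] using H.dist_le (p.map f.toHom)
    · have hle := G.dist_le ((q.map f.symm.toHom).copy (f.symm_apply_apply u) (f.symm_apply_apply v))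
      simpa [hq] using hle
  · rw [SimpleGraph.dist_eq_zero_of_not_reachable h,
      SimpleGraph.dist_eq_zero_of_not_reachable (mt f.reachable_iff.1 h)]

lemma wienerIndex_congr [Fintype V] [Fintype W] (f : G ≃g H) : wienerIndex G = wienerIndex H := by
  have htotal (v : V) : totalDist G v = totalDist H (f v) :=
    Fintype.sum_equiv f.toEquiv _ _ fun u => (dist_map_iso f v u).symm
  simp only [wienerIndex, htotal]
  congr 1
  exact Fintype.sum_equiv f.toEquiv _ _ fun v => rfl

theorem connected_and_dist_eq [Nonempty V] {D : V → V → ℕ} (self : ∀ u, D u u = 0)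
    (lipschitz : ∀ u v v', G.Adj v v' → D u v' ≤ D u v + 1)
    (descent : ∀ u v, u ≠ v → ∃ v', G.Adj v v' ∧ D u v' < D u v) :
    G.Connected ∧ ∀ u v, G.dist u v = D u v := by
  have exists_walk (u v : V) : ∃ p : G.Walk v u, p.length ≤ D u v := by
    induction hN : D u v using Nat.strong_induction_on generalizing v with
    | _ N ih =>
      obtain rfl | huv := eq_or_ne u v
      · exact ⟨.nil, Nat.zero_le _⟩
      · obtain ⟨v', hadj, hlt⟩ := descent u v huv
        obtain ⟨p, hp⟩ := ih _ (hN ▸ hlt) v' rfl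
        exact ⟨.cons hadj p, by rw [SimpleGraph.Walk.length_cons]; omega⟩
  have le_length (u : V) {v w : V} (p : G.Walk v w) : D u w ≤ D u v + p.length := by
    induction p with
    | nil => simp
    | cons hadj p ih =>
      have := lipschitz u _ _ hadj
      rw [SimpleGraph.Walk.length_cons]
      omega
  have hconn : G.Connected := ⟨fun u v => (exists_walk v u).choose.reachable⟩
  refine ⟨hconn, fun u v => le_antisymm ?_ ?_⟩
  · obtain ⟨p, hp⟩ := exists_walk u v
    exact SimpleGraph.dist_comm.trans_le ((G.dist_le p).trans hp)
  · obtain ⟨p, hp⟩ := hconn.exists_walk_length_eq_dist u v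
    simpa [self, hp] using le_length u p

end Metric

section CyclicCoordinates

/-- The distance of two points on a cycle of length `N`. -/
def cyclicDist {N : ℕ} (x y : ZMod N) : ℕ := (x - y).valMinAbs.natAbs

@[simp]
lemma cyclicDist_self {N : ℕ} (x : ZMod N) : cyclicDist x x = 0 := by
  simp [cyclicDist]

lemma cyclicDist_comm {N : ℕ} (x y : ZMod N) : cyclicDist x y = cyclicDist y x := by
  rw [cyclicDist, cyclicDist, ← neg_sub y x, ZMod.natAbs_valMinAbs_neg]

lemma cyclicDist_triangle {N : ℕ} (x y z : ZMod N) :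
    cyclicDist x z ≤ cyclicDist x y + cyclicDist y z := by
  have := ZMod.natAbs_valMinAbs_add_le (x - y) (y - z)
  rw [sub_add_sub_cancel] at this
  exact this.trans (Int.natAbs_add_le _ _)

lemma natAbs_valMinAbs_intCast_le {N : ℕ} (a : ℤ) :
    (a : ZMod N).valMinAbs.natAbs ≤ a.natAbs := by
  obtain rfl | hN := eq_zero_or_neZero N
  · exact le_rfl
  · exact ZMod.natAbs_min_of_le_div_two N _ _ (ZMod.coe_valMinAbs _) (ZMod.natAbs_valMinAbs_le _)

lemma cyclicDist_add_one_le {N : ℕ} (x y : ZMod N) :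
    cyclicDist x (y + 1) ≤ cyclicDist x y + 1 ∧ cyclicDist x y ≤ cyclicDist x (y + 1) + 1 := by
  have hone : cyclicDist (y + 1) y ≤ 1 := by
    simpa [cyclicDist] using natAbs_valMinAbs_intCast_le (N := N) 1
  have hsucc := cyclicDist_triangle x y (y + 1)
  have hpred := cyclicDist_triangle x (y + 1) y
  rw [cyclicDist_comm y (y + 1)] at hsucc
  omega

lemma cyclicDist_succ_lt_or_pred_lt {N : ℕ} {x y : ZMod N} (h : x ≠ y) :
    cyclicDist x (y + 1) < cyclicDist x y ∨ cyclicDist x (y - 1) < cyclicDist x y := by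
  set a := (x - y).valMinAbs with ha
  have hxy : x - y = (a : ZMod N) := by rw [ha, ZMod.coe_valMinAbs]
  have ha0 : a ≠ 0 := by rwa [ha, Ne, ZMod.valMinAbs_eq_zero, sub_eq_zero]
  have hsucc : cyclicDist x (y + 1) ≤ (a - 1).natAbs := by
    simpa [cyclicDist, ← hxy, sub_sub] using natAbs_valMinAbs_intCast_le (N := N) (a - 1)
  have hpred : cyclicDist x (y - 1) ≤ (a + 1).natAbs := by
    simpa [cyclicDist, ← hxy, sub_add] using natAbs_valMinAbs_intCast_le (N := N) (a + 1)
  have : cyclicDist x y = a.natAbs := rfl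
  omega

variable {V ι : Type*} {N : ι → ℕ}

/-- The step from `v` to `v'` advances the cyclic coordinate `c` by one and keeps all the other
coordinates. -/
def AdvancesOnly (x : (c : ι) → V → ZMod (N c)) (c : ι) (v v' : V) : Prop :=
  x c v' = x c v + 1 ∧ ∀ d ≠ c, x d v' = x d v

variable [Fintype ι] {x : (c : ι) → V → ZMod (N c)} {c : ι} {u v v' : V}

lemma AdvancesOnly.sum_cyclicDist (h : AdvancesOnly x c v v') (u : V) :
    ∑ d, cyclicDist (x d u) (x d v') + cyclicDist (x c u) (x c v) =
      ∑ d, cyclicDist (x d u) (x d v) + cyclicDist (x c u) (x c v') := by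
  classical
  rw [← Finset.add_sum_erase _ _ (Finset.mem_univ c),
    ← Finset.add_sum_erase _ (fun d => cyclicDist (x d u) (x d v)) (Finset.mem_univ c),
    Finset.sum_congr rfl fun d hd => by rw [h.2 d (Finset.ne_of_mem_erase hd)]]
  ring

lemma AdvancesOnly.sum_cyclicDist_le (h : AdvancesOnly x c v v') (u : V) :
    ∑ d, cyclicDist (x d u) (x d v') ≤ ∑ d, cyclicDist (x d u) (x d v) + 1 ∧
      ∑ d, cyclicDist (x d u) (x d v) ≤ ∑ d, cyclicDist (x d u) (x d v') + 1 := by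
  have hsum := h.sum_cyclicDist u
  have hstep := cyclicDist_add_one_le (x c u) (x c v)
  rw [h.1] at hsum
  omega

theorem connected_and_dist_eq_sum_cyclicDist [Nonempty V] {r : V → V → Prop}
    (advances : ∀ v v', r v v' → ∃ c, AdvancesOnly x c v v')
    (separates : ∀ u v, u ≠ v → ∃ c, x c u ≠ x c v ∧
      (∃ v', r v v' ∧ AdvancesOnly x c v v') ∧ ∃ v', r v' v ∧ AdvancesOnly x c v' v) :
    (SimpleGraph.fromRel r).Connected ∧
      ∀ u v, (SimpleGraph.fromRel r).dist u v = ∑ c, cyclicDist (x c u) (x c v) := by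
  refine connected_and_dist_eq (fun u => by simp) ?_ ?_
  · rintro u v v' ⟨-, h | h⟩
    · obtain ⟨c, hc⟩ := advances _ _ h
      exact (hc.sum_cyclicDist_le u).1
    · obtain ⟨c, hc⟩ := advances _ _ h
      exact (hc.sum_cyclicDist_le u).2
  · intro u v huv
    obtain ⟨c, hne, ⟨v', hr, hv'⟩, v'', hr', hv''⟩ := separates u v huv
    have hlt := cyclicDist_succ_lt_or_pred_lt hne
    rw [← hv'.1, ← eq_sub_of_add_eq hv''.1.symm] at hlt
    have hsum := hv'.sum_cyclicDist u
    have hsum' := hv''.sum_cyclicDist u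
    rcases hlt with hlt | hlt
    · refine ⟨v', ⟨?_, .inl hr⟩, by omega⟩
      rintro rfl
      exact lt_irrefl _ hlt
    · refine ⟨v'', ⟨?_, .inr hr'⟩, by omega⟩
      rintro rfl
      exact lt_irrefl _ hlt

end CyclicCoordinates

local notation:67 w:67 "▷" a:68 => Fin.snoc (α := fun _ => _) w a

section Odometer

variable {X Y : Type*} {G : SimpleGraph X} {n : ℕ}

lemma snoc_const (x : X) : ((fun _ : Fin n => x) ▷ x) = fun _ => x :=
  Fin.snoc_init_self fun _ : Fin (n + 1) => x

lemma act_none (o : EdgeOrientation G) (w : Fin n → X) : (graphAutomaton o).act none w = w := by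
  induction n with
  | zero => rfl
  | succ n ih =>
    rw [Automaton.act]
    change Fin.cons (w 0) ((graphAutomaton o).act none (Fin.tail w)) = w
    rw [ih, Fin.cons_self_tail]

variable [DecidableEq X] [DecidableEq Y]

/-- The action of the edge `{x, y}`, oriented from `x` to `y`, on words: adding one to a binary
counter whose digits `x` and `y` stand for one and zero, least significant digit first. -/
def odometer (x y : X) (w : Fin n → X) : Fin n → X :=
  fun j => if ∀ i < j, w i = x then Equiv.swap x y (w j) else w j

lemma odometer_snoc (x y : X) (w : Fin n → X) (a : X) :
    odometer x y (w ▷ a) =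
      odometer x y w ▷ (if w = fun _ => x then Equiv.swap x y a else a) := by
  funext j
  refine Fin.lastCases ?_ (fun j => ?_) j
  · simp [odometer, Fin.forall_fin_succ', funext_iff, Fin.castSucc_lt_last]
  · have hlt : ¬ Fin.last n < j.castSucc := (Fin.le_last _).not_gt
    simp [odometer, Fin.forall_fin_succ', hlt]

lemma odometer_const (x y : X) : odometer x y (fun _ : Fin n => x) = fun _ => y := by
  funext j
  simp [odometer]

lemma odometer_odometer (x y : X) (w : Fin n → X) : odometer y x (odometer x y w) = w := by
  induction w using Fin.snocInduction with
  | elim0 => exact Subsingleton.elim _ _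
  | snoc w a ih =>
    have hconst : odometer x y w = (fun _ => y) ↔ w = fun _ => x := by
      refine ⟨fun h => ?_, fun h => h ▸ odometer_const x y⟩
      rw [← ih, h, odometer_const]
    rw [odometer_snoc, odometer_snoc, ih]
    simp only [hconst, Equiv.swap_comm y x]
    split_ifs <;> simp

lemma odometer_comp (f : X ≃ Y) (x y : X) (w : Fin n → X) :
    odometer (f x) (f y) (f ∘ w) = f ∘ odometer x y w := by
  funext j
  simp only [odometer, Function.comp, EmbeddingLike.apply_eq_iff_eq]
  split_ifs
  · simp [Equiv.swap_apply_def, apply_ite f]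
  · rfl

/-- The graph on words in which every edge of `G` acts by the odometer exchanging its ends. -/
def odometerGraph (G : SimpleGraph X) (n : ℕ) : SimpleGraph (Fin n → X) :=
  SimpleGraph.fromRel fun u v => ∃ x y, G.Adj x y ∧ odometer x y u = v

/-- A graph isomorphism, applied letter by letter. -/
def odometerGraphIso {G : SimpleGraph X} {H : SimpleGraph Y} (φ : G ≃g H) (n : ℕ) :
    odometerGraph G n ≃g odometerGraph H n where
  toEquiv := (Equiv.refl _).arrowCongr φ.toEquiv
  map_rel_iff' := by
    have key (u v : Fin n → X) : (∃ x y, H.Adj x y ∧ odometer x y (φ ∘ u) = φ ∘ v) ↔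
        ∃ x y, G.Adj x y ∧ odometer x y u = v := by
      have hcomp (x y : X) : odometer (φ x) (φ y) (φ ∘ u) = φ ∘ odometer x y u :=
        odometer_comp φ.toEquiv x y u
      simp only [φ.surjective.exists, hcomp, φ.map_adj_iff, φ.injective.comp_left.eq_iff]
    intro u v
    simp only [odometerGraph, SimpleGraph.fromRel_adj, Ne, EmbeddingLike.apply_eq_iff_eq]
    exact and_congr_right fun _ => or_congr (key u v) (key v u)

lemma act_some (o : EdgeOrientation G) (e : o.arcs) (w : Fin n → X) :
    (graphAutomaton o).act (some e) w = odometer e.1.1 e.1.2 w := by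
  induction n with
  | zero => exact Subsingleton.elim _ _
  | succ n ih =>
    rw [Automaton.act]
    funext j
    refine Fin.cases ?_ (fun j => ?_) j
    · simp only [graphAutomaton, Fin.cons_zero, odometer, Equiv.swap_apply_def, Fin.not_lt_zero,
        IsEmpty.forall_iff, implies_true, if_true]
      congr
    · rw [Fin.cons_succ]
      by_cases h : w 0 = e.1.1
      · have hr : (graphAutomaton o).restr (some e) (w 0) = some e := if_pos h
        rw [hr, ih]
        simp only [odometer, Fin.tail, Fin.forall_fin_succ, h, Fin.succ_pos, forall_const,
          Fin.succ_lt_succ_iff, true_and]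
        congr
      · have hr : (graphAutomaton o).restr (some e) (w 0) = none := if_neg h
        rw [hr, act_none]
        simp [odometer, Fin.forall_fin_succ, Fin.tail, h]

theorem schreierGraph_eq_odometerGraph (o : EdgeOrientation G) (n : ℕ) :
    (graphAutomaton o).schreierGraph n = odometerGraph G n := by
  ext u v
  simp only [Automaton.schreierGraph, odometerGraph, SimpleGraph.fromRel_adj]
  refine and_congr_right fun huv => ⟨?_, ?_⟩
  · have of_act {u v : Fin n → X} (huv : u ≠ v) :
        (∃ q, (graphAutomaton o).act q u = v) → ∃ x y, G.Adj x y ∧ odometer x y u = v := by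
      rintro ⟨_ | e, rfl⟩
      · exact absurd (act_none o u).symm huv
      · exact ⟨e.1.1, e.1.2, o.adj_of_mem e.2, (act_some o e u).symm⟩
    exact Or.imp (of_act huv) (of_act huv.symm)
  · have of_odometer {u v : Fin n → X} : (∃ x y, G.Adj x y ∧ odometer x y u = v) →
        (∃ q, (graphAutomaton o).act q u = v) ∨ ∃ q, (graphAutomaton o).act q v = u := by
      rintro ⟨x, y, hadj, rfl⟩
      refine (o.xor_of_adj hadj).or.imp (fun h => ?_) fun h => ?_
      · exact ⟨some ⟨_, h⟩, act_some o _ u⟩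
      · exact ⟨some ⟨_, h⟩, (act_some o _ _).trans (odometer_odometer x y u)⟩
    exact Or.rec of_odometer (Or.symm ∘ of_odometer)

end Odometer

section Position

variable {m n : ℕ}

/-- The edge `i` of the path joins the letters `i.castSucc` and `i.succ`. -/
def Incident (i : Fin m) (a : Fin (m + 1)) : Prop := a = i.castSucc ∨ a = i.succ

instance (i : Fin m) : DecidablePred (Incident i) := fun _ => instDecidableOr

/-- The words on the full cycle of the edge `i`, those that the edge moves in a cycle of the maximal
length `2 ^ n`. -/
def OnFullCycle (i : Fin m) (w : Fin n → Fin (m + 1)) : Prop := ∀ t, Incident i (w t)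

instance (i : Fin m) : DecidablePred (OnFullCycle (n := n) i) := fun _ => Nat.decidableForallFin _

/-- The action of the edge `i` of the path, oriented upwards. -/
def step (i : Fin m) (w : Fin n → Fin (m + 1)) : Fin n → Fin (m + 1) :=
  odometer i.castSucc i.succ w

/-- The position of (the projection of) a word on the full cycle of the edge `i`, read as a binary
number with least significant digit first, where `i.castSucc` stands for one and `i.succ` for zero.
The branch containing a word that ends in another letter is attached to the cycle at the constant
word whose letter is the nearer end of the edge. -/
def position (i : Fin m) : {n : ℕ} → (Fin n → Fin (m + 1)) → ℕ
  | 0, _ => 0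
  | n + 1, w =>
    if w (Fin.last n) = i.castSucc then position i (Fin.init w) + 2 ^ n
    else if w (Fin.last n) = i.succ then position i (Fin.init w)
    else if w (Fin.last n) < i.castSucc then 2 ^ (n + 1) - 1 else 0

lemma onFullCycle_snoc {i : Fin m} {w : Fin n → Fin (m + 1)} {a : Fin (m + 1)} :
    OnFullCycle i (w ▷ a) ↔ OnFullCycle i w ∧ Incident i a := by
  simp [OnFullCycle, Fin.forall_fin_succ']

lemma onFullCycle_const (i : Fin m) : OnFullCycle i fun _ : Fin n => i.castSucc := fun _ => .inl rfl

lemma swap_of_not_incident {i : Fin m} {a : Fin (m + 1)} (ha : ¬ Incident i a) :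
    Equiv.swap i.castSucc i.succ a = a :=
  Equiv.swap_apply_of_ne_of_ne (fun h => ha (.inl h)) fun h => ha (.inr h)

lemma incident_swap {i : Fin m} {a : Fin (m + 1)} :
    Incident i (Equiv.swap i.castSucc i.succ a) ↔ Incident i a := by
  rw [Incident, Incident, Equiv.swap_apply_eq_iff, Equiv.swap_apply_eq_iff, Equiv.swap_apply_left,
    Equiv.swap_apply_right, or_comm]

lemma onFullCycle_step {i : Fin m} {w : Fin n → Fin (m + 1)} :
    OnFullCycle i (step i w) ↔ OnFullCycle i w := by
  refine forall_congr' fun t => ?_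
  rw [step, odometer]
  split_ifs
  · exact incident_swap
  · rfl

lemma step_snoc_of_carry (i : Fin m) (a : Fin (m + 1)) :
    step i ((fun _ : Fin n => i.castSucc) ▷ a) =
      (fun _ => i.succ) ▷ Equiv.swap i.castSucc i.succ a := by
  rw [step, odometer_snoc, if_pos rfl, odometer_const]

lemma step_snoc {i : Fin m} {w : Fin n → Fin (m + 1)} {a : Fin (m + 1)}
    (h : w = (fun _ => i.castSucc) → ¬ Incident i a) : step i (w ▷ a) = step i w ▷ a := by
  rw [step, step, odometer_snoc]
  split_ifs with hw
  · rw [swap_of_not_incident (h hw)]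
  · rfl

lemma step_snoc_of_not_onFullCycle {i : Fin m} {w : Fin n → Fin (m + 1)} {a : Fin (m + 1)}
    (h : ¬ OnFullCycle i (w ▷ a)) : step i (w ▷ a) = step i w ▷ a :=
  step_snoc fun hw ha => h (onFullCycle_snoc.2 ⟨hw ▸ onFullCycle_const i, ha⟩)

lemma position_snoc (i : Fin m) (w : Fin n → Fin (m + 1)) (a : Fin (m + 1)) :
    position i (w ▷ a) = if a = i.castSucc then position i w + 2 ^ n
      else if a = i.succ then position i w
      else if a < i.castSucc then 2 ^ (n + 1) - 1 else 0 := by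
  simp [position]

lemma position_snoc_castSucc (i : Fin m) (w : Fin n → Fin (m + 1)) :
    position i (w ▷ i.castSucc) = position i w + 2 ^ n := by
  rw [position_snoc, if_pos rfl]

lemma position_snoc_succ (i : Fin m) (w : Fin n → Fin (m + 1)) :
    position i (w ▷ i.succ) = position i w := by
  rw [position_snoc, if_neg Fin.castSucc_lt_succ.ne', if_pos rfl]

lemma position_lt (i : Fin m) (w : Fin n → Fin (m + 1)) : position i w < 2 ^ n := by
  induction w using Fin.snocInduction with
  | elim0 => simp [position]
  | snoc w a ih =>
    rw [position_snoc, pow_succ]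
    split_ifs <;> omega

lemma position_const (i : Fin m) (a : Fin (m + 1)) :
    position i (fun _ : Fin n => a) = if a ≤ i.castSucc then 2 ^ n - 1 else 0 := by
  induction n with
  | zero => simp [position]
  | succ n ih =>
    rw [← snoc_const, position_snoc, ih]
    rw [pow_succ]
    split_ifs <;> simp only [Fin.ext_iff, Fin.le_def, Fin.lt_def, Fin.val_castSucc,
      Fin.val_succ] at * <;> omega

lemma natCast_position_inj {i : Fin m} {u v : Fin n → Fin (m + 1)} :
    (position i u : ZMod (2 ^ n)) = position i v ↔ position i u = position i v := by
  rw [ZMod.natCast_eq_natCast_iff', Nat.mod_eq_of_lt (position_lt i u),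
    Nat.mod_eq_of_lt (position_lt i v)]

lemma position_step {i : Fin m} {w : Fin n → Fin (m + 1)} (h : OnFullCycle i w)
    (hne : w ≠ fun _ => i.castSucc) : position i (step i w) = position i w + 1 := by
  induction w using Fin.snocInduction with
  | elim0 => exact absurd (Subsingleton.elim _ _) hne
  | @snoc n w a ih =>
    obtain ⟨hw, ha⟩ := onFullCycle_snoc.1 h
    by_cases hcarry : w = fun _ => i.castSucc
    · subst hcarry
      obtain rfl : a = i.succ := ha.resolve_left fun ha => hne (ha ▸ snoc_const _)
      rw [step_snoc_of_carry, Equiv.swap_apply_right, position_snoc_castSucc, position_snoc_succ,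
        position_const, position_const, if_pos le_rfl, if_neg Fin.castSucc_lt_succ.not_ge]
      have := Nat.two_pow_pos n
      omega
    · rw [step_snoc fun hw => absurd hw hcarry]
      obtain rfl | rfl := ha
      · rw [position_snoc_castSucc, position_snoc_castSucc, ih hw hcarry, add_right_comm]
      · rw [position_snoc_succ, position_snoc_succ, ih hw hcarry]

lemma natCast_two_pow_sub_one (n : ℕ) : ((2 ^ n - 1 : ℕ) : ZMod (2 ^ n)) = -1 := by
  rw [Nat.cast_sub Nat.one_le_two_pow, ZMod.natCast_self, Nat.cast_one, zero_sub]

lemma natCast_position_step {i : Fin m} {w : Fin n → Fin (m + 1)} (h : OnFullCycle i w) :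
    (position i (step i w) : ZMod (2 ^ n)) = position i w + 1 := by
  by_cases hw : w = fun _ => i.castSucc
  · rw [hw, step, odometer_const, position_const, position_const, if_pos le_rfl,
      if_neg Fin.castSucc_lt_succ.not_ge, natCast_two_pow_sub_one, Nat.cast_zero, neg_add_cancel]
  · rw [position_step h hw, Nat.cast_add_one]

lemma position_step_of_not_onFullCycle {i : Fin m} {w : Fin n → Fin (m + 1)}
    (h : ¬ OnFullCycle i w) : position i (step i w) = position i w := by
  induction w using Fin.snocInduction with
  | elim0 => exact absurd (fun t => t.elim0) h
  | snoc w a ih =>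
    rw [step_snoc_of_not_onFullCycle h, position_snoc, position_snoc]
    by_cases ha : Incident i a
    · rw [ih fun hw => h (onFullCycle_snoc.2 ⟨hw, ha⟩)]
    · obtain ⟨hcastSucc, hsucc⟩ := not_or.1 ha
      simp only [if_neg hcastSucc, if_neg hsucc]

lemma position_const_succ_of_ne {i j : Fin m} (hij : j ≠ i) :
    position i (fun _ : Fin n => j.succ) = position i fun _ : Fin n => j.castSucc := by
  have hle : j.succ ≤ i.castSucc ↔ j.castSucc ≤ i.castSucc := by
    simp only [Fin.le_def, Fin.val_castSucc, Fin.val_succ]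
    omega
  simp only [position_const, hle]

lemma position_step_of_ne {i j : Fin m} (hij : j ≠ i) (w : Fin n → Fin (m + 1)) :
    position i (step j w) = position i w := by
  induction w using Fin.snocInduction with
  | elim0 => rfl
  | @snoc n w a ih =>
    by_cases hcarry : w = fun _ => j.castSucc
    · subst hcarry
      rw [step_snoc_of_carry]
      by_cases ha : Incident j a
      · obtain rfl | rfl := ha
        · rw [Equiv.swap_apply_left, snoc_const, snoc_const, position_const_succ_of_ne hij]
        · rw [Equiv.swap_apply_right, position_snoc, position_snoc, position_const, position_const,
            pow_succ]
          simp only [Fin.ext_iff, Fin.le_def, Fin.lt_def, Fin.val_castSucc, Fin.val_succ]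
          split_ifs <;> omega
      · rw [swap_of_not_incident ha, position_snoc, position_snoc, position_const_succ_of_ne hij]
    · rw [step_snoc fun hw => absurd hw hcarry, position_snoc, position_snoc, ih]

end Position

section Cycles

/-- Indices of the cyclic coordinates of the words of length `n` over `Fin (m + 1)`: the cycles that
the edges trace on all words (`full i`), and the cycles inside the copies of the words of length
`n - 1` obtained by fixing the last letter (`copy b c`). -/
inductive CycleIndex (m : ℕ) : ℕ → Type
  | full {n : ℕ} (i : Fin m) : CycleIndex m n
  | copy {n : ℕ} (b : Fin (m + 1)) (c : CycleIndex m n) : CycleIndex m (n + 1)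

namespace CycleIndex

variable {m n : ℕ}

/-- The cycle has length `2 ^ c.level`. -/
def level : {n : ℕ} → CycleIndex m n → ℕ
  | n, full _ => n
  | _, copy _ c => c.level

/-- The cycle `copy b c` is one half of a full cycle. -/
def Merges (b : Fin (m + 1)) : {n : ℕ} → CycleIndex m n → Prop
  | _, full i => Incident i b
  | _, copy _ _ => False

lemma not_merges_copy (a b : Fin (m + 1)) (c : CycleIndex m n) : ¬ (copy a c).Merges b := id

instance (b : Fin (m + 1)) : DecidablePred (Merges (n := n) b)
  | full i => inferInstanceAs (Decidable (Incident i b))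
  | copy _ _ => inferInstanceAs (Decidable False)

/-- On words of length zero there are only the full cycles. -/
def equivZero : CycleIndex m 0 ≃ Fin m where
  toFun | full i => i
  invFun := full
  left_inv | full _ => rfl
  right_inv _ := rfl

/-- The index of a cycle, split according to its constructor. -/
def equivSucc : CycleIndex m (n + 1) ≃ Fin m ⊕ Fin (m + 1) × CycleIndex m n where
  toFun
    | full i => .inl i
    | copy b c => .inr (b, c)
  invFun := Sum.elim full fun p => copy p.1 p.2
  left_inv
    | full _ => rfl
    | copy _ _ => rfl
  right_inv
    | .inl _ => rfl
    | .inr _ => rfl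

instance : (n : ℕ) → Fintype (CycleIndex m n)
  | 0 => .ofEquiv _ equivZero.symm
  | n + 1 => haveI := instFintype n; .ofEquiv _ equivSucc.symm

lemma sum_zero {M : Type*} [AddCommMonoid M] (F : CycleIndex m 0 → M) :
    ∑ c, F c = ∑ i, F (full i) :=
  (equivZero.symm.sum_comp F).symm

lemma sum_succ {M : Type*} [AddCommMonoid M] (F : CycleIndex m (n + 1) → M) :
    ∑ c, F c = ∑ i, F (full i) + ∑ b, ∑ c, F (copy b c) := by
  rw [← equivSucc.symm.sum_comp F, Fintype.sum_sum_type, Fintype.sum_prod_type]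
  rfl

end CycleIndex

open CycleIndex

variable {m n : ℕ}

/-- The retraction of the words of length `n + 1` onto the copy of the words of length `n` with last
letter `b`: all the other copies are attached to it at the constant word. -/
def retract (b : Fin (m + 1)) (u : Fin (n + 1) → Fin (m + 1)) : Fin n → Fin (m + 1) :=
  if u (Fin.last n) = b then Fin.init u else fun _ => b

/-- The coordinate of a word on a cycle. A cycle merging into a full cycle gets the trivial
coordinate, for it would be counted twice otherwise. -/
def coord : {n : ℕ} → (c : CycleIndex m n) → (Fin n → Fin (m + 1)) → ZMod (2 ^ c.level)
  | _, full i, u => position i u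
  | _, copy b c, u => if c.Merges b then 0 else coord c (retract b u)

/-- The cycle along which the edge `i` moves a word. -/
def cycleOf (i : Fin m) : {n : ℕ} → (Fin n → Fin (m + 1)) → CycleIndex m n
  | 0, _ => full i
  | n + 1, v => if OnFullCycle i v then full i else copy (v (Fin.last n)) (cycleOf i (Fin.init v))

lemma retract_snoc (b : Fin (m + 1)) (w : Fin n → Fin (m + 1)) (a : Fin (m + 1)) :
    retract b (w ▷ a) = if a = b then w else fun _ => b := by
  simp [retract]

lemma retract_snoc_self (b : Fin (m + 1)) (w : Fin n → Fin (m + 1)) : retract b (w ▷ b) = w := by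
  rw [retract_snoc, if_pos rfl]

lemma cycleOf_eq_full {i : Fin m} {v : Fin n → Fin (m + 1)} (h : OnFullCycle i v) :
    cycleOf i v = full i := by
  cases n with
  | zero => rfl
  | succ n => rw [cycleOf, if_pos h]

lemma cycleOf_snoc {i : Fin m} {w : Fin n → Fin (m + 1)} {a : Fin (m + 1)}
    (h : ¬ OnFullCycle i (w ▷ a)) : cycleOf i (w ▷ a) = copy a (cycleOf i w) := by
  rw [cycleOf, if_neg h, Fin.snoc_last, Fin.init_snoc]

lemma merges_cycleOf {i : Fin m} {w : Fin n → Fin (m + 1)} {a : Fin (m + 1)} :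
    (cycleOf i w).Merges a ↔ OnFullCycle i (w ▷ a) := by
  rw [onFullCycle_snoc]
  by_cases hw : OnFullCycle i w
  · rw [cycleOf_eq_full hw]
    exact (and_iff_right hw).symm
  · refine iff_of_false (fun hmerges => ?_) fun h => hw h.1
    induction w using Fin.snocInduction with
    | elim0 => exact hw fun t => t.elim0
    | snoc w b _ =>
      rw [cycleOf_snoc hw] at hmerges
      exact hmerges

lemma coord_copy_of_merges {b : Fin (m + 1)} {c : CycleIndex m n} (h : c.Merges b)
    (u : Fin (n + 1) → Fin (m + 1)) : coord (copy b c) u = 0 :=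
  if_pos h

lemma coord_copy {b : Fin (m + 1)} {c : CycleIndex m n} (h : ¬ c.Merges b)
    (u : Fin (n + 1) → Fin (m + 1)) : coord (copy b c) u = coord c (retract b u) :=
  if_neg h

lemma cycleOf_step (i : Fin m) (v : Fin n → Fin (m + 1)) : cycleOf i (step i v) = cycleOf i v := by
  induction v using Fin.snocInduction with
  | elim0 => rfl
  | snoc w a ih =>
    by_cases h : OnFullCycle i (w ▷ a)
    · rw [cycleOf_eq_full h, cycleOf_eq_full (onFullCycle_step.2 h)]
    · have hstep := mt onFullCycle_step.1 h
      rw [step_snoc_of_not_onFullCycle h] at hstep ⊢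
      rw [cycleOf_snoc h, cycleOf_snoc hstep, ih]

lemma coord_cycleOf_step (i : Fin m) (v : Fin n → Fin (m + 1)) :
    coord (cycleOf i v) (step i v) = coord (cycleOf i v) v + 1 := by
  induction v using Fin.snocInduction with
  | elim0 => exact natCast_position_step fun t => t.elim0
  | snoc w a ih =>
    by_cases h : OnFullCycle i (w ▷ a)
    · rw [cycleOf_eq_full h]
      exact natCast_position_step h
    · have hmerges := mt merges_cycleOf.1 h
      rw [cycleOf_snoc h, coord_copy hmerges, coord_copy hmerges, step_snoc_of_not_onFullCycle h,
        retract_snoc_self, retract_snoc_self]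
      exact ih

lemma coord_full_step {i j : Fin m} {v : Fin n → Fin (m + 1)} (h : full j ≠ cycleOf i v) :
    coord (full j) (step i v) = coord (full j) v := by
  have hposition : position j (step i v) = position j v := by
    obtain rfl | hij := eq_or_ne i j
    · exact position_step_of_not_onFullCycle fun hv => h (cycleOf_eq_full hv).symm
    · exact position_step_of_ne hij v
  exact congrArg Nat.cast hposition

lemma retract_step (i : Fin m) (b : Fin (m + 1)) (w : Fin n → Fin (m + 1)) (a : Fin (m + 1)) :
    retract b (step i (w ▷ a)) = retract b (w ▷ a) ∨
      retract b (step i (w ▷ a)) = step i (retract b (w ▷ a)) ∧ retract b (w ▷ a) = w ∧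
        (a = b ∨ w = (fun _ => i.castSucc) ∧ Incident i b) := by
  by_cases h : w = (fun _ => i.castSucc) ∧ Incident i a
  · obtain ⟨rfl, ha⟩ := h
    rw [step_snoc_of_carry, retract_snoc, retract_snoc, step]
    by_cases hb : Incident i b
    · obtain rfl | rfl := ha <;> obtain rfl | rfl := hb <;>
        simp [odometer_const, Incident, Fin.castSucc_lt_succ.ne, Fin.castSucc_lt_succ.ne']
    · left
      rw [if_neg, if_neg]
      · rintro rfl
        exact hb ha
      · rintro rfl
        exact hb (incident_swap.2 ha)
  · rw [step_snoc fun hw ha => h ⟨hw, ha⟩, retract_snoc, retract_snoc]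
    split_ifs with hab
    · exact .inr ⟨rfl, rfl, .inl hab⟩
    · exact .inl rfl

lemma coord_step_of_ne {i : Fin m} {v : Fin n → Fin (m + 1)} {c : CycleIndex m n}
    (h : c ≠ cycleOf i v) : coord c (step i v) = coord c v := by
  induction v using Fin.snocInduction with
  | elim0 =>
    cases c
    rfl
  | snoc w a ih =>
    cases c with
    | full j => exact coord_full_step h
    | copy b c =>
      by_cases hmerges : c.Merges b
      · rw [coord_copy_of_merges hmerges, coord_copy_of_merges hmerges]
      · rw [coord_copy hmerges, coord_copy hmerges]
        obtain heq | ⟨heq, hw, hb⟩ := retract_step i b w a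
        · rw [heq]
        · rw [heq, hw]
          refine ih ?_
          rintro rfl
          obtain rfl | ⟨rfl, hb⟩ := hb
          · exact h (cycleOf_snoc (mt merges_cycleOf.2 hmerges)).symm
          · rw [cycleOf_eq_full (onFullCycle_const i)] at hmerges
            exact hmerges hb

lemma advancesOnly_step (i : Fin m) (v : Fin n → Fin (m + 1)) :
    AdvancesOnly coord (cycleOf i v) v (step i v) :=
  ⟨coord_cycleOf_step i v, fun _ => coord_step_of_ne⟩

lemma position_ne_of_retract_ne {i : Fin m} {a : Fin (m + 1)} {v : Fin (n + 1) → Fin (m + 1)}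
    {w : Fin n → Fin (m + 1)} (ha : Incident i a) (h : position i (retract a v) ≠ position i w) :
    position i v ≠ position i (w ▷ a) := by
  cases v using Fin.snocCases with | snoc u b
  have hu := position_lt i u
  have hw := position_lt i w
  rw [retract_snoc] at h
  split_ifs at h with hb
  · subst hb
    obtain rfl | rfl := ha
    · rwa [position_snoc_castSucc, position_snoc_castSucc, Ne, Nat.add_left_inj]
    · rwa [position_snoc_succ, position_snoc_succ]
  · rw [position_const] at h
    obtain rfl | rfl := ha
    · rw [if_pos le_rfl] at h
      rw [position_snoc, position_snoc_castSucc, pow_succ]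
      split_ifs <;> omega
    · rw [if_neg Fin.castSucc_lt_succ.not_ge] at h
      rw [position_snoc, position_snoc_succ, pow_succ]
      split_ifs <;> omega

lemma exists_position_ne_const {a b : Fin (m + 1)} (hab : b ≠ a) (u : Fin n → Fin (m + 1)) :
    ∃ i, Incident i a ∧ position i (u ▷ b) ≠ position i fun _ : Fin (n + 1) => a := by
  have hu (i : Fin m) := position_lt i u
  have hpos := Nat.two_pow_pos n
  obtain hlt | hlt := hab.lt_or_gt
  · obtain ⟨i, rfl⟩ := Fin.exists_succ_eq.2 (Fin.ne_zero_of_lt hlt)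
    refine ⟨i, .inr rfl, ?_⟩
    rw [position_snoc, position_const, if_neg Fin.castSucc_lt_succ.not_ge, pow_succ]
    have hle : b ≤ i.castSucc := Fin.le_castSucc_iff.2 hlt
    split_ifs <;> omega
  · obtain ⟨i, rfl⟩ := Fin.exists_castSucc_eq.2 (Fin.ne_last_of_lt hlt)
    refine ⟨i, .inl rfl, ?_⟩
    rw [position_snoc, position_const, if_pos le_rfl, if_neg hab, if_neg hlt.not_gt, pow_succ]
    specialize hu i
    split_ifs <;> omega

lemma exists_coord_cycleOf_ne {u v : Fin n → Fin (m + 1)} (huv : u ≠ v) :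
    ∃ i, coord (cycleOf i v) u ≠ coord (cycleOf i v) v := by
  induction v using Fin.snocInduction with
  | elim0 => exact absurd (Subsingleton.elim _ _) huv
  | @snoc n w a ih =>
    cases u using Fin.snocCases with | snoc u b
    by_cases hu : retract a (u ▷ b) = w
    · have hab : b ≠ a := by
        rintro rfl
        exact huv (by rw [← hu, retract_snoc_self])
      rw [retract_snoc, if_neg hab] at hu
      obtain ⟨i, ha, hi⟩ := exists_position_ne_const hab u
      refine ⟨i, ?_⟩
      rw [← hu, snoc_const, cycleOf_eq_full fun _ => ha]
      exact natCast_position_inj.not.2 hi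
    · obtain ⟨i, hi⟩ := ih hu
      refine ⟨i, ?_⟩
      by_cases h : OnFullCycle i (w ▷ a)
      · obtain ⟨hw, ha⟩ := onFullCycle_snoc.1 h
        rw [cycleOf_eq_full hw] at hi
        rw [cycleOf_eq_full h]
        exact natCast_position_inj.not.2
          (position_ne_of_retract_ne ha (natCast_position_inj.not.1 hi))
      · have hmerges := mt merges_cycleOf.1 h
        rw [cycleOf_snoc h, coord_copy hmerges, coord_copy hmerges, retract_snoc_self]
        exact hi

lemma odometerGraph_pathGraph : odometerGraph (SimpleGraph.pathGraph (m + 1)) n =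
    SimpleGraph.fromRel fun u v => ∃ i : Fin m, step i u = v := by
  have exists_edge {x y : Fin (m + 1)} (h : x.val + 1 = y.val) :
      ∃ i : Fin m, i.castSucc = x ∧ i.succ = y :=
    ⟨⟨x, by omega⟩, rfl, Fin.ext h⟩
  have adj_castSucc_succ (i : Fin m) : (SimpleGraph.pathGraph (m + 1)).Adj i.castSucc i.succ := by
    simp [SimpleGraph.pathGraph_adj]
  have exists_step {u v : Fin n → Fin (m + 1)} :
      (∃ x y, (SimpleGraph.pathGraph (m + 1)).Adj x y ∧ odometer x y u = v) →
        (∃ i : Fin m, step i u = v) ∨ ∃ i : Fin m, step i v = u := by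
    rintro ⟨x, y, hadj, rfl⟩
    obtain hxy | hyx := SimpleGraph.pathGraph_adj.1 hadj
    · obtain ⟨i, rfl, rfl⟩ := exists_edge hxy
      exact .inl ⟨i, rfl⟩
    · obtain ⟨i, rfl, rfl⟩ := exists_edge hyx
      exact .inr ⟨i, odometer_odometer _ _ u⟩
  ext u v
  simp only [odometerGraph, SimpleGraph.fromRel_adj]
  refine and_congr_right fun _ => ⟨Or.rec exists_step (Or.symm ∘ exists_step), Or.imp ?_ ?_⟩
  all_goals
    rintro ⟨i, h⟩
    exact ⟨_, _, adj_castSucc_succ i, h⟩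

/-- The distance of the projections of two words to a cycle. -/
def cycleDist (c : CycleIndex m n) (u v : Fin n → Fin (m + 1)) : ℕ :=
  cyclicDist (coord c u) (coord c v)

theorem odometerGraph_pathGraph_connected_and_dist_eq (m n : ℕ) :
    (odometerGraph (SimpleGraph.pathGraph (m + 1)) n).Connected ∧
      ∀ u v, (odometerGraph (SimpleGraph.pathGraph (m + 1)) n).dist u v =
        ∑ c : CycleIndex m n, cycleDist c u v := by
  rw [odometerGraph_pathGraph]
  refine connected_and_dist_eq_sum_cyclicDist (x := coord) ?_ fun u v huv => ?_
  · rintro v _ ⟨i, rfl⟩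
    exact ⟨cycleOf i v, advancesOnly_step i v⟩
  · obtain ⟨i, hi⟩ := exists_coord_cycleOf_ne huv
    have hstep : step i (odometer i.succ i.castSucc v) = v := odometer_odometer _ _ v
    have hcycle := cycleOf_step i (odometer i.succ i.castSucc v)
    have hadvances := advancesOnly_step i (odometer i.succ i.castSucc v)
    rw [hstep] at hcycle hadvances
    exact ⟨cycleOf i v, hi, ⟨_, ⟨i, rfl⟩, advancesOnly_step i v⟩,
      ⟨_, ⟨i, hstep⟩, hcycle ▸ hadvances⟩⟩

end Cycles

section CyclicSums

lemma cyclicDist_add_half {M N : ℕ} [NeZero M] (hM : M = 2 * N) (x y : ZMod M) :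
    cyclicDist (x + (N : ZMod M)) y + cyclicDist x y = N := by
  set a := (x - y).valMinAbs with ha
  have hxy : x - y = (a : ZMod M) := by rw [ha, ZMod.coe_valMinAbs]
  have hM0 : (2 * N : ZMod M) = 0 := by
    rw [← Nat.cast_ofNat, ← Nat.cast_mul, ← hM, ZMod.natCast_self]
  obtain ⟨hlt, hle⟩ : -(M : ℤ) < a * 2 ∧ a * 2 ≤ M := ZMod.valMinAbs_mem_Ioc (x - y)
  have hhalf : (x + (N : ZMod M) - y).valMinAbs = if 0 < a then a - N else a + N := by
    refine (ZMod.valMinAbs_spec _ _).2 ⟨?_, ?_⟩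
    · split_ifs
      · push_cast
        linear_combination hxy + hM0
      · push_cast
        linear_combination hxy
    · split_ifs <;> constructor <;> omega
  rw [cyclicDist, cyclicDist, hhalf, ← ha]
  split_ifs <;> omega

lemma cyclicDist_neg_one_zero {N : ℕ} (hN : 2 ≤ N) : cyclicDist (-1 : ZMod N) 0 = 1 := by
  have hone : (1 : ZMod N).valMinAbs = 1 := by
    have : NeZero N := ⟨by omega⟩
    exact (ZMod.valMinAbs_spec _ _).2 ⟨by simp, by constructor <;> omega⟩
  rw [cyclicDist, sub_zero, ZMod.natAbs_valMinAbs_neg, hone, Int.natAbs_one]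

end CyclicSums

section Sums

open CycleIndex

variable {m n : ℕ}

lemma sum_snoc {X M : Type*} [Fintype X] [AddCommMonoid M] (F : (Fin (n + 1) → X) → M) :
    ∑ u, F u = ∑ a, ∑ w, F (w ▷ a) := by
  rw [← (Fin.snocEquiv fun _ => X).sum_comp, Fintype.sum_prod_type]
  rfl

lemma sum_ite_le_castSucc (i : Fin m) (x y : ℚ) :
    ∑ a : Fin (m + 1), (if a ≤ i.castSucc then x else y) = (i + 1) * x + (m - i) * y := by
  have hle : Finset.univ.filter (· ≤ i.castSucc) = Finset.Iic i.castSucc := by ext; simp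
  have hnot : Finset.univ.filter (¬ · ≤ i.castSucc) = Finset.Ioi i.castSucc := by ext; simp
  have hi : i.val ≤ m := i.is_lt.le
  rw [Finset.sum_ite, hle, hnot]
  simp [hi]

lemma sum_letters (i : Fin m) {f : Fin (m + 1) → ℚ} {x y : ℚ} (hx : ∀ a < i.castSucc, f a = x)
    (hy : ∀ a > i.succ, f a = y) :
    ∑ a, f a = f i.castSucc + f i.succ + i * x + (m - 1 - i) * y := by
  have hf (a : Fin (m + 1)) : f a = (if a = i.castSucc then f i.castSucc - x else 0) +
      (if a = i.succ then f i.succ - y else 0) + if a ≤ i.castSucc then x else y := by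
    obtain hlt | rfl | hgt := lt_trichotomy a i.castSucc
    · simp [hlt.ne, hlt.le, (hlt.trans Fin.castSucc_lt_succ).ne, hx a hlt]
    · simp [Fin.castSucc_lt_succ.ne]
    · obtain rfl | hne := eq_or_ne a i.succ
      · simp [hgt.ne', hgt.not_ge]
      · have hsucc : i.succ < a := lt_of_le_of_ne (Fin.castSucc_lt_iff_succ_le.1 hgt) hne.symm
        simp [hgt.ne', hgt.not_ge, hne, hy a hsucc]
  rw [Finset.sum_congr rfl fun a _ => hf a, Finset.sum_add_distrib, Finset.sum_add_distrib,
    sum_ite_le_castSucc, Finset.sum_ite_eq', Finset.sum_ite_eq']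
  simp only [Finset.mem_univ, if_true]
  ring

lemma sum_ite_merges_full (n : ℕ) (i : Fin m) (f : Fin (m + 1) → ℚ) {x y : ℚ}
    (hx : ∀ a < i.castSucc, f a = x) (hy : ∀ a > i.succ, f a = y) :
    ∑ a, (if (full i : CycleIndex m n).Merges a then 0 else f a) = i * x + (m - 1 - i) * y := by
  rw [sum_letters i (x := x) (y := y), if_pos (.inl rfl), if_pos (.inr rfl), zero_add, zero_add]
  · intro a ha
    rw [if_neg, hx a ha]
    rintro (rfl | rfl)
    · exact ha.false
    · exact ha.not_gt Fin.castSucc_lt_succ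
  · intro a ha
    rw [if_neg, hy a ha]
    rintro (rfl | rfl)
    · exact ha.not_gt Fin.castSucc_lt_succ
    · exact ha.false

lemma sum_mul_sub (x : ℚ) (n : ℕ) :
    ∑ i ∈ Finset.range n, (i : ℚ) * (x - i) = n * (n - 1) * (3 * x + 1 - 2 * n) / 6 := by
  induction n with
  | zero => simp
  | succ n ih =>
    rw [Finset.sum_range_succ, ih]
    push_cast
    ring

lemma sum_edges (m : ℕ) :
    ∑ i : Fin m, (i : ℚ) * (m - 1 - i) = m * (m - 1) * (m - 2) / 6 := by
  rw [Fin.sum_univ_eq_sum_range fun i => (i : ℚ) * (m - 1 - i), sum_mul_sub]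
  ring

lemma card_words (m n : ℕ) : (Fintype.card (Fin n → Fin (m + 1)) : ℚ) = (m + 1) ^ n := by
  simp

lemma sum_retract (b : Fin (m + 1)) (F : (Fin n → Fin (m + 1)) → ℚ) :
    ∑ u, F (retract b u) = ∑ w, F w + m * (m + 1) ^ n * F fun _ => b := by
  simp only [sum_snoc, retract_snoc]
  have hother : ∀ a ∈ Finset.univ.erase b, ∑ w : Fin n → Fin (m + 1),
      F (if a = b then w else fun _ => b) = (m + 1) ^ n * F fun _ => b := by
    intro a ha
    simp [Finset.ne_of_mem_erase ha]
  rw [← Finset.add_sum_erase _ _ (Finset.mem_univ b), Finset.sum_congr rfl hother]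
  simp [mul_assoc]

lemma cycleDist_full (i : Fin m) (u v : Fin n → Fin (m + 1)) : cycleDist (full i) u v =
    cyclicDist (position i u : ZMod (2 ^ n)) (position i v) := rfl

lemma cycleDist_comm (c : CycleIndex m n) (u v : Fin n → Fin (m + 1)) :
    cycleDist c u v = cycleDist c v u :=
  cyclicDist_comm _ _

lemma cycleDist_self (c : CycleIndex m n) (u : Fin n → Fin (m + 1)) : cycleDist c u u = 0 :=
  cyclicDist_self _

/-- The sum of the distances on a cycle of the ordered pairs of words. -/
def pairSum (c : CycleIndex m n) : ℚ := ∑ u, ∑ v, (cycleDist c u v : ℚ)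

/-- The sum of the distances on a cycle of the words from a constant word; the words with a common
last letter are connected to the other words through such a word. -/
def rootSum (c : CycleIndex m n) (a : Fin (m + 1)) : ℚ := ∑ u, (cycleDist c u fun _ => a : ℚ)

lemma cycleDist_of_length_zero (c : CycleIndex m 0) (u v : Fin 0 → Fin (m + 1)) :
    cycleDist c u v = 0 := by
  rw [Subsingleton.elim u v, cycleDist_self]

lemma sum_cyclicDist_position (i : Fin m) (q : ZMod (2 ^ (n + 1))) :
    ∑ u : Fin (n + 1) → Fin (m + 1), (cyclicDist (position i u : ZMod (2 ^ (n + 1))) q : ℚ) =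
      (m + 1) ^ n * (2 ^ n + i * cyclicDist (-1) q + (m - 1 - i) * cyclicDist 0 q) := by
  have hletters (w : Fin n → Fin (m + 1)) :
      ∑ a, (cyclicDist (position i (w ▷ a) : ZMod (2 ^ (n + 1))) q : ℚ) =
        2 ^ n + i * cyclicDist (-1) q + (m - 1 - i) * cyclicDist 0 q := by
    have hhalf := cyclicDist_add_half (pow_succ' 2 n) (position i w : ZMod (2 ^ (n + 1))) q
    rw [sum_letters i (x := cyclicDist (-1) q) (y := cyclicDist 0 q), position_snoc_castSucc,
      position_snoc_succ, Nat.cast_add, ← Nat.cast_add, hhalf, Nat.cast_pow, Nat.cast_ofNat]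
    · intro a ha
      rw [position_snoc, if_neg ha.ne, if_neg (ha.trans Fin.castSucc_lt_succ).ne, if_pos ha,
        natCast_two_pow_sub_one]
    · intro a ha
      have hgt : i.castSucc < a := Fin.castSucc_lt_succ.trans ha
      rw [position_snoc, if_neg hgt.ne', if_neg ha.ne', if_neg hgt.not_gt, Nat.cast_zero]
  rw [sum_snoc, Finset.sum_comm, Finset.sum_congr rfl fun w _ => hletters w, Finset.sum_const,
    Finset.card_univ, nsmul_eq_mul, card_words]

lemma rootSum_full (i : Fin m) (a : Fin (m + 1)) :
    rootSum (full i : CycleIndex m (n + 1)) a =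
      (m + 1) ^ n * (2 ^ n + if a ≤ i.castSucc then (m - 1 - i : ℚ) else i) := by
  have hcyc : cyclicDist (-1 : ZMod (2 ^ (n + 1))) 0 = 1 :=
    cyclicDist_neg_one_zero (Nat.le_self_pow n.succ_ne_zero 2)
  simp only [rootSum, cycleDist_full]
  rw [sum_cyclicDist_position, position_const]
  split_ifs
  · rw [natCast_two_pow_sub_one, cyclicDist_self, cyclicDist_comm, hcyc]
    push_cast
    ring
  · rw [Nat.cast_zero, cyclicDist_self, hcyc]
    push_cast
    ring

lemma pairSum_full (i : Fin m) : pairSum (full i : CycleIndex m (n + 1)) =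
    (m + 1) ^ (2 * n) * (2 * 2 ^ n * m + 2 * (i * (m - 1 - i))) := by
  have hcyc : cyclicDist (-1 : ZMod (2 ^ (n + 1))) 0 = 1 :=
    cyclicDist_neg_one_zero (Nat.le_self_pow n.succ_ne_zero 2)
  simp only [pairSum, cycleDist_full]
  rw [Finset.sum_comm]
  simp only [sum_cyclicDist_position]
  rw [← Finset.mul_sum, Finset.sum_add_distrib, Finset.sum_add_distrib, ← Finset.mul_sum,
    ← Finset.mul_sum]
  simp only [cyclicDist_comm (-1) _, cyclicDist_comm 0 _]
  rw [sum_cyclicDist_position, sum_cyclicDist_position, cyclicDist_self, cyclicDist_self, hcyc,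
    cyclicDist_comm 0, hcyc, Finset.sum_const, Finset.card_univ, nsmul_eq_mul, card_words]
  push_cast
  ring

lemma cycleDist_copy_of_merges {b : Fin (m + 1)} {c : CycleIndex m n} (h : c.Merges b)
    (u v : Fin (n + 1) → Fin (m + 1)) : cycleDist (copy b c) u v = 0 := by
  rw [cycleDist, coord_copy_of_merges h, coord_copy_of_merges h, cyclicDist_self]

lemma cycleDist_copy {b : Fin (m + 1)} {c : CycleIndex m n} (h : ¬ c.Merges b)
    (u v : Fin (n + 1) → Fin (m + 1)) :
    cycleDist (copy b c) u v = cycleDist c (retract b u) (retract b v) := by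
  rw [cycleDist, coord_copy h, coord_copy h]
  rfl

lemma rootSum_copy (b : Fin (m + 1)) (c : CycleIndex m n) (a : Fin (m + 1)) :
    rootSum (copy b c) a = if c.Merges b then 0 else rootSum c b := by
  split_ifs with h
  · simp [rootSum, cycleDist_copy_of_merges h]
  · have hretract : retract b (fun _ => a) = fun _ : Fin n => b := by
      rw [← snoc_const, retract_snoc]
      split_ifs with hab
      · rw [hab]
      · rfl
    simp only [rootSum, cycleDist_copy h, hretract]
    rw [sum_retract b fun w => (cycleDist c w fun _ => b : ℚ), cycleDist_self, Nat.cast_zero,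
      mul_zero, add_zero]

lemma pairSum_copy (b : Fin (m + 1)) (c : CycleIndex m n) : pairSum (copy b c) =
    if c.Merges b then 0 else pairSum c + 2 * m * (m + 1) ^ n * rootSum c b := by
  split_ifs with h
  · simp [pairSum, cycleDist_copy_of_merges h]
  · have hinner (w : Fin n → Fin (m + 1)) : ∑ v, (cycleDist c w (retract b v) : ℚ) =
        ∑ v, (cycleDist c w v : ℚ) + m * (m + 1) ^ n * cycleDist c w fun _ => b :=
      sum_retract b fun v => (cycleDist c w v : ℚ)
    simp only [pairSum, cycleDist_copy h, hinner, Finset.sum_add_distrib, ← Finset.mul_sum]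
    rw [sum_retract b fun w => ∑ v, (cycleDist c w v : ℚ),
      sum_retract b fun w => (cycleDist c w fun _ => b : ℚ), cycleDist_self]
    simp only [cycleDist_comm c (fun _ => b), rootSum]
    push_cast
    ring

lemma sum_merges (F : CycleIndex m n → ℚ) :
    ∑ b, ∑ c : CycleIndex m n, (if c.Merges b then 0 else F c) =
      (m + 1) * ∑ c, F c - 2 * ∑ i, F (full i) := by
  have hfull : ∑ b, ∑ i : Fin m, (if (full i : CycleIndex m n).Merges b then 0 else F (full i)) =
      (m - 1) * ∑ i, F (full i) := by
    rw [Finset.sum_comm, Finset.mul_sum]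
    refine Finset.sum_congr rfl fun i _ => ?_
    rw [sum_ite_merges_full n i _ (fun _ _ => rfl) fun _ _ => rfl]
    ring
  cases n with
  | zero =>
    simp only [sum_zero, hfull]
    ring
  | succ n =>
    simp only [sum_succ, not_merges_copy, Finset.sum_add_distrib, hfull, if_false,
      Finset.sum_const, Finset.card_univ, Fintype.card_fin, nsmul_eq_mul]
    push_cast
    ring

/-- The sum of the distances on all the full cycles of the ordered pairs of words. -/
def fullPairSum (m n : ℕ) : ℚ := ∑ i, pairSum (full i : CycleIndex m n)

/-- The sum of the distances on all the cycles of the ordered pairs of words. -/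
def totalPairSum (m n : ℕ) : ℚ := ∑ c : CycleIndex m n, pairSum c

/-- The sum over all the letters of the distances of the words from the constant word, on the cycles
which remain when that letter is appended. -/
def totalRootSum (m n : ℕ) : ℚ :=
  ∑ b, ∑ c : CycleIndex m n, if c.Merges b then 0 else rootSum c b

lemma fullPairSum_succ (m n : ℕ) : fullPairSum m (n + 1) =
    (m + 1) ^ (2 * n) * (2 * 2 ^ n * m ^ 2 + m * (m - 1) * (m - 2) / 3) := by
  simp only [fullPairSum, pairSum_full, Finset.sum_add_distrib, ← Finset.mul_sum, sum_edges]
  simp only [Finset.sum_const, Finset.card_univ, Fintype.card_fin, nsmul_eq_mul]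
  ring

lemma totalPairSum_succ (m n : ℕ) : totalPairSum m (n + 1) =
    fullPairSum m (n + 1) + (m + 1) * totalPairSum m n - 2 * fullPairSum m n +
      2 * m * (m + 1) ^ n * totalRootSum m n := by
  have hcopy (b : Fin (m + 1)) (c : CycleIndex m n) : pairSum (copy b c) =
      (if c.Merges b then 0 else pairSum c) +
        2 * m * (m + 1) ^ n * if c.Merges b then 0 else rootSum c b := by
    rw [pairSum_copy]
    split_ifs <;> ring
  rw [totalPairSum, sum_succ]
  simp only [hcopy, Finset.sum_add_distrib, ← Finset.mul_sum, sum_merges]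
  rw [fullPairSum, fullPairSum, totalPairSum, totalRootSum]
  ring

lemma totalRootSum_succ (m n : ℕ) : totalRootSum m (n + 1) =
    (m + 1) * totalRootSum m n +
      (m + 1) ^ n * (m * (m - 1) * 2 ^ n + m * (m - 1) * (m - 2) / 3) := by
  have hfull (i : Fin m) :
      ∑ b, (if (full i : CycleIndex m (n + 1)).Merges b then 0
        else rootSum (full i : CycleIndex m (n + 1)) b) =
          (m + 1) ^ n * ((m - 1) * 2 ^ n + 2 * (i * (m - 1 - i))) := by
    rw [sum_ite_merges_full _ i (x := (m + 1) ^ n * (2 ^ n + (m - 1 - i)))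
      (y := (m + 1) ^ n * (2 ^ n + i))]
    · ring
    · intro a ha
      rw [rootSum_full, if_pos ha.le]
    · intro a ha
      rw [rootSum_full, if_neg (Fin.castSucc_lt_succ.trans ha).not_ge]
  rw [totalRootSum]
  simp only [sum_succ, not_merges_copy, if_false, rootSum_copy, Finset.sum_add_distrib]
  rw [Finset.sum_comm]
  simp only [hfull, Finset.sum_add_distrib, ← Finset.mul_sum, sum_edges, Finset.sum_const,
    Finset.card_univ, Fintype.card_fin, nsmul_eq_mul]
  rw [← totalRootSum]
  push_cast
  ring

lemma totalRootSum_eq (m n : ℕ) : (m + 1) * totalRootSum m n =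
    (m + 1) ^ n * (m * (m - 1) * (2 ^ n - 1) + n * (m * (m - 1) * (m - 2)) / 3) := by
  induction n with
  | zero => simp [totalRootSum, rootSum, cycleDist_of_length_zero]
  | succ n ih =>
    rw [totalRootSum_succ, mul_add, ih]
    push_cast
    ring

lemma totalPairSum_one (m : ℕ) : totalPairSum m 1 = fullPairSum m 1 := by
  rw [totalPairSum_succ]
  simp [totalPairSum, fullPairSum, totalRootSum, pairSum, rootSum, cycleDist_of_length_zero]

theorem half_totalPairSum_eq (m n : ℕ) {k : ℚ} (hk : k = m + 1) :
    1 / 2 * totalPairSum m (n + 1) =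
      (k - 1) ^ 2 * (2 * k ^ 2 - 2 * k - 1) / (k ^ 3 * (2 * k - 1)) *
          (2 ^ (n + 1) * k ^ (2 * (n + 1)))
        + (k - 1) * (k - 2) * (k - 3) / (3 * k ^ 2) * ((n + 1 : ℕ) * k ^ (2 * (n + 1)))
        - (k + 1) * (k - 2) * (k ^ 2 + 2 * k - 6) / (6 * k ^ 3) * k ^ (2 * (n + 1))
        + (k + 1) * (k - 2) * (2 * k - 5) / (6 * k * (2 * k - 1)) * k ^ (n + 1) := by
  have hk0 : k ≠ 0 := by rw [hk]; positivity
  have hk1 : 2 * k - 1 ≠ 0 := by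
    have : 2 * k - 1 = 2 * m + 1 := by rw [hk]; ring
    rw [this]
    positivity
  have hm : (m : ℚ) = k - 1 := by rw [hk]; ring
  induction n with
  | zero =>
    rw [totalPairSum_one, fullPairSum_succ, ← hk, hm]
    push_cast
    field_simp
    ring
  | succ n ih =>
    have hroot := totalRootSum_eq m (n + 1)
    rw [totalPairSum_succ, fullPairSum_succ, fullPairSum_succ]
    rw [← hk, hm] at hroot ⊢
    calc
      _ = k * (1 / 2 * totalPairSum m (n + 1)) +
            k ^ (2 * (n + 1)) * (2 ^ (n + 1) * (k - 1) ^ 2 + (k - 1) * (k - 2) * (k - 3) / 6) -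
            k ^ (2 * n) * (2 * 2 ^ n * (k - 1) ^ 2 + (k - 1) * (k - 2) * (k - 3) / 3) +
            (k - 1) * k ^ n * (k * totalRootSum m (n + 1)) := by ring
      _ = _ := by
        rw [ih, hroot]
        rw [mul_comm 2 k] at hk1 ⊢
        push_cast
        field_simp
        ring

theorem wienerIndex_odometerGraph_pathGraph (m n : ℕ) :
    wienerIndex (odometerGraph (SimpleGraph.pathGraph (m + 1)) n) = 1 / 2 * totalPairSum m n := by
  have hdist := (odometerGraph_pathGraph_connected_and_dist_eq m n).2
  have htotal : ∑ u, ∑ v, ∑ c : CycleIndex m n, (cycleDist c u v : ℚ) = totalPairSum m n := by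
    simp only [totalPairSum, pairSum]
    rw [Finset.sum_congr rfl fun u _ => Finset.sum_comm, Finset.sum_comm]
  simp only [wienerIndex, totalDist, hdist, Nat.cast_sum, htotal]

end Sums

end GraphAutomaton

theorem mainTheorem10 {V : Type*} [Fintype V] (G : SimpleGraph V) (o : GraphAutomaton.EdgeOrientation G)
    (k n : ℕ) (hk : 1 ≤ k) (hn : 1 ≤ n) (hG : Nonempty (G ≃g SimpleGraph.pathGraph k)) :
    ((GraphAutomaton.graphAutomaton o).schreierGraph n).Connected ∧
    GraphAutomaton.wienerIndex ((GraphAutomaton.graphAutomaton o).schreierGraph n) =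
      ((k : ℚ) - 1) ^ 2 * (2 * (k : ℚ) ^ 2 - 2 * k - 1) / ((k : ℚ) ^ 3 * (2 * k - 1))
          * (2 ^ n * (k : ℚ) ^ (2 * n))
        + ((k : ℚ) - 1) * (k - 2) * (k - 3) / (3 * (k : ℚ) ^ 2) * (n * (k : ℚ) ^ (2 * n))
        - ((k : ℚ) + 1) * (k - 2) * ((k : ℚ) ^ 2 + 2 * k - 6) / (6 * (k : ℚ) ^ 3)
          * (k : ℚ) ^ (2 * n)
        + ((k : ℚ) + 1) * (k - 2) * (2 * k - 5) / (6 * k * (2 * k - 1)) * (k : ℚ) ^ n := by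
  classical
  obtain ⟨φ⟩ := hG
  obtain ⟨m, rfl⟩ := Nat.exists_eq_add_of_le' hk
  obtain ⟨n, rfl⟩ := Nat.exists_eq_add_of_le' hn
  let φn := GraphAutomaton.odometerGraphIso φ (n + 1)
  rw [GraphAutomaton.schreierGraph_eq_odometerGraph]
  refine ⟨φn.connected_iff.2
    (GraphAutomaton.odometerGraph_pathGraph_connected_and_dist_eq m (n + 1)).1, ?_⟩
  rw [GraphAutomaton.wienerIndex_congr φn, GraphAutomaton.wienerIndex_odometerGraph_pathGraph]
  exact GraphAutomaton.half_totalPairSum_eq m n (Nat.cast_succ m)
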